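/- Let $\ell_2$ be the real Hilbert space of square-summable sequences, with unit vector basis $(e_n)_{n\ge 1}$. For a real Banach space $X$, let $B_X$ be its closed unit ball. A *relatively weakly open subset* of $B_X$ is the intersection of $B_X$ with a weakly open subset of $X$. Let $x\in X$ with $\|x\|=1$. - $x$ is a *super Daugavet point* if $\sup_{y\in V}\|x-y\|=2$ for every non-empty relatively weakly open subset $V$ of $B_X$. - $x$ is a *ccw $\Delta$-point* if $\sup_{y\in C}\|x-y\|=2$ for every set $C=\sum_{i=1}^n\lambda_iW_i$ containing $x$, where $\lambda_i\ge 0$, $\sum_{i=1}^n\lambda_i=1$, and $W_1,\dots,W_n$ are non-empty relatively weakly open subsets of $B_X$. **Theorem.** There exists a norm $|||\cdot|||$ on $\ell_2$, equivalent to the usual one, such that, for $X=(\ell_2,|||\cdot|||)$: 1. $e_1$ is an extreme point of $B_X$, a super Daugavet point of $X$, and a ccw $\Delta$-point of $X$; 2. the first coordinate functional $e_1^*=\langle e_1,\cdot\rangle$ (that is, $e_1$ under the usual identification of $\ell_2^*$ with $\ell_2$) is an extreme point of $B_{X^*}$, a super Daugavet point of $X^*$, and a ccw $\Delta$-point of $X^*$,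 where $X^*$ carries the dual norm of $|||\cdot|||$ and its weak topology. -/

import Mathlib

noncomputable section

/-- An equivalent norm on the real normed space `X`: a seminorm `p` on `X` such that
`c * ‖x‖ ≤ p x ≤ C * ‖x‖` for all `x`, for some constants `c, C > 0`. -/
structure EquivalentNorm (X : Type*) [NormedAddCommGroup X] [NormedSpace ℝ X] where
  toSeminorm : Seminorm ℝ X
  exists_lower : ∃ c : ℝ, 0 < c ∧ ∀ x, c * ‖x‖ ≤ toSeminorm x
  exists_upper : ∃ C : ℝ, 0 < C ∧ ∀ x, toSeminorm x ≤ C * ‖x‖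

/-- The vector space `X`, endowed with the equivalent norm `N` (the renorming `(X, N)`). -/
def Renormed {X : Type*} [NormedAddCommGroup X] [NormedSpace ℝ X]
    (_N : EquivalentNorm X) : Type _ := X

namespace Renormed

variable {X : Type*} [NormedAddCommGroup X] [NormedSpace ℝ X] (N : EquivalentNorm X)

instance : AddCommGroup (Renormed N) := inferInstanceAs (AddCommGroup X)

instance : Module ℝ (Renormed N) := inferInstanceAs (Module ℝ X)

/-- The identity map of the underlying vector space, from `X` to `(X, N)`. -/
def ofLinearEquiv : X ≃ₗ[ℝ] Renormed N := LinearEquiv.refl ℝ X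

instance : Norm (Renormed N) := ⟨fun x => N.toSeminorm ((ofLinearEquiv N).symm x)⟩

theorem norm_of (x : X) : ‖ofLinearEquiv N x‖ = N.toSeminorm x := rfl

theorem core : NormedSpace.Core ℝ (Renormed N) where
  norm_nonneg x := apply_nonneg N.toSeminorm ((ofLinearEquiv N).symm x)
  norm_smul c x := map_smul_eq_mul N.toSeminorm c ((ofLinearEquiv N).symm x)
  norm_triangle x y :=
    map_add_le_add N.toSeminorm ((ofLinearEquiv N).symm x) ((ofLinearEquiv N).symm y)
  norm_eq_zero_iff x := by
    constructor
    · intro h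
      obtain ⟨c, hc, hN⟩ := N.exists_lower
      have h1 : c * ‖(ofLinearEquiv N).symm x‖ ≤ 0 := (hN _).trans_eq h
      have h2 : ‖(ofLinearEquiv N).symm x‖ ≤ 0 := nonpos_of_mul_nonpos_right h1 hc
      exact (ofLinearEquiv N).symm.map_eq_zero_iff.mp (norm_le_zero_iff.mp h2)
    · rintro rfl
      exact map_zero N.toSeminorm

instance : NormedAddCommGroup (Renormed N) := NormedAddCommGroup.ofCore (core N)

instance : NormedSpace ℝ (Renormed N) := NormedSpace.ofCore (core N)

/-- The identity map from `X` to `(X, N)`, as an isomorphism of topological vector spaces. -/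
def of : X ≃L[ℝ] Renormed N :=
  { ofLinearEquiv N with
    continuous_toFun := by
      obtain ⟨C, _, hC⟩ := N.exists_upper
      exact AddMonoidHomClass.continuous_of_bound (ofLinearEquiv N) C hC
    continuous_invFun := by
      obtain ⟨c, hc, hN⟩ := N.exists_lower
      refine AddMonoidHomClass.continuous_of_bound (ofLinearEquiv N).symm c⁻¹ fun x => ?_
      rw [inv_mul_eq_div, le_div_iff₀' hc]
      exact hN _ }

end Renormed

/-- `V` is a relatively weakly open subset of the closed unit ball of `X`: the intersection of
the ball with a subset of `X` that is open for the weak topology. -/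
def IsRelWeaklyOpen {X : Type*} [NormedAddCommGroup X] [NormedSpace ℝ X] (V : Set X) : Prop :=
  ∃ U : Set (WeakSpace ℝ X), IsOpen U ∧ V = Metric.closedBall (0 : X) 1 ∩ toWeakSpace ℝ X ⁻¹' U

/-- `x ∈ S_X` is a super Daugavet point: `sup_{y ∈ V} ‖x - y‖ = 2` for every non-empty relatively
weakly open subset `V` of the closed unit ball. -/
def IsSuperDaugavetPoint {X : Type*} [NormedAddCommGroup X] [NormedSpace ℝ X] (x : X) : Prop :=
  ‖x‖ = 1 ∧ ∀ V : Set X, IsRelWeaklyOpen V → V.Nonempty → IsLUB ((fun y => ‖x - y‖) '' V) 2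

/-- `C` is a convex combination `∑ i, w i • W i` (Minkowski sum) of finitely many non-empty
relatively weakly open subsets `W i` of the closed unit ball. -/
def IsConvexCombinationOfWeaklyOpen {X : Type*} [NormedAddCommGroup X] [NormedSpace ℝ X]
    (C : Set X) : Prop :=
  ∃ (n : ℕ) (w : Fin n → ℝ) (W : Fin n → Set X),
    (∀ i, 0 ≤ w i) ∧ ∑ i, w i = 1 ∧ (∀ i, IsRelWeaklyOpen (W i) ∧ (W i).Nonempty) ∧
      C = {y | ∃ z : Fin n → X, (∀ i, z i ∈ W i) ∧ y = ∑ i, w i • z i}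

/-- `x ∈ S_X` is a ccw Δ-point: `sup_{y ∈ C} ‖x - y‖ = 2` for every convex combination `C` of
non-empty relatively weakly open subsets of the closed unit ball such that `x ∈ C`. -/
def IsCcwDeltaPoint {X : Type*} [NormedAddCommGroup X] [NormedSpace ℝ X] (x : X) : Prop :=
  ‖x‖ = 1 ∧ ∀ C : Set X, IsConvexCombinationOfWeaklyOpen C → x ∈ C →
    IsLUB ((fun y => ‖x - y‖) '' C) 2

/-- The real Hilbert space `ℓ₂` of square-summable sequences. -/
abbrev RealEll2 : Type := lp (fun _ : ℕ => ℝ) 2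

/-- The first vector of the unit vector basis of `ℓ₂` (coordinates are indexed from `0`). -/
def ellE1 : RealEll2 := lp.single 2 0 1

/-- The first unit vector, seen through the canonical (Riesz) identification of `ℓ₂` with its dual
as the functional `⟪e₁, ·⟫`, that is, the first coordinate functional, on the renormed space
`(ℓ₂, N)`. The norm of `StrongDual ℝ (Renormed N)` is the dual norm of `N`. -/
def ellE1Dual (N : EquivalentNorm RealEll2) : StrongDual ℝ (Renormed N) :=
  (innerSL ℝ ellE1).comp ((Renormed.of N).symm : Renormed N →L[ℝ] RealEll2)

end

/-!
Write a vector of `ℓ₂` as `x = (t, w)`, where `t` is the coordinate of index `0` and `w` is the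
tail, and let `w⁺`, `w⁻` be the positive and negative parts of `w`. The norm is

  `N (t, w) = max (‖w⁺‖ - t) (‖w⁻‖ + t)`,

whose unit ball is the convex hull of `K ∪ -K` with `K = {(1, w) : w ≥ 0, ‖w‖ ≤ 2}`.

* `e₁ = (1, 0)` is extreme, because it is the vertex of the positive cone inside the face `K`
  (`eq_ellE1_of_sum_smul_eq`).
* `e₁` is a super Daugavet point: if `N (t, w) ≤ 1`, replace one far coordinate of `w` by the
  number `s ≥ 0` for which the new tail `v` satisfies `‖v⁺‖ = 1 + t`. The new vector stays in the
  ball, it is at distance exactly `2` from `e₁` (`exists_update_dist_eq_two`), and it converges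
  weakly to `(t, w)` as the index of the coordinate tends to infinity, since only one coordinate is
  perturbed, by a bounded amount (`eventually_mem_of_isOpen_weak`).
* `e₁` is a ccw `Δ`-point: by extremality, a convex combination of weakly open sets `W i` contains
  `e₁` only if `e₁ ∈ W i` for every `i` of positive weight, and then these `W i` all contain the
  same vector `e₁ + 2 eₙ` of the ball, for `n` large.
* The polar of `K ∪ -K` shows that the dual norm of `(s, φ)` is `max (s + 2 ‖φ⁺‖) (-s + 2 ‖φ⁻‖)`,
  so that `(t, w) ↦ (t, -w/2)` is an isometry of the renormed space onto its dual
  (`norm_dualMap`). It maps `e₁` to the first coordinate functional.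

So both halves of the theorem are instances of one statement about a surjective linear map `Φ` on
`ℓ₂` into a normed space with `‖Φ x‖ = N x`.
-/

open Filter Topology

/-! ### The positive part of the tail -/

/-- The positive part of the tail: the coordinate of index `0` is set to zero, and every other
coordinate is replaced by its positive part. -/
def tailPos (x : RealEll2) : RealEll2 :=
  ⟨fun n => if n = 0 then 0 else max (x n) 0, (lp.memℓp x).mono' fun n => by
    simp only [Real.norm_eq_abs]
    split_ifs
    · simp
    · rw [abs_of_nonneg (le_max_right _ _)]
      exact max_le (le_abs_self _) (abs_nonneg _)⟩

theorem tailPos_apply (x : RealEll2) (n : ℕ) :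
    tailPos x n = if n = 0 then 0 else max (x n) 0 := rfl

theorem tailPos_zero_coord (x : RealEll2) : tailPos x 0 = 0 := rfl

theorem tailPos_apply_of_ne (x : RealEll2) {n : ℕ} (hn : n ≠ 0) :
    tailPos x n = max (x n) 0 := by
  rw [tailPos_apply, if_neg hn]

theorem tailPos_apply_nonneg (x : RealEll2) (n : ℕ) : 0 ≤ tailPos x n := by
  rw [tailPos_apply]
  split_ifs
  · exact le_rfl
  · exact le_max_right _ _

theorem ellE1_apply_zero : ellE1 0 = 1 := lp.single_apply_self 2 0 1

theorem ellE1_apply_of_ne {n : ℕ} (hn : n ≠ 0) : ellE1 n = 0 := lp.single_apply_ne 2 0 1 hn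

theorem single_apply_real (n m : ℕ) (c : ℝ) :
    (lp.single 2 n c : RealEll2) m = if m = n then c else 0 := by
  split_ifs with h
  · subst h
    exact lp.single_apply_self _ _ _
  · exact lp.single_apply_ne _ _ _ h

theorem norm_le_of_abs_apply_le {x y : RealEll2} (h : ∀ n, |x n| ≤ |y n|) : ‖x‖ ≤ ‖y‖ :=
  lp.norm_mono two_ne_zero h

theorem norm_tailPos_le (x : RealEll2) : ‖tailPos x‖ ≤ ‖x‖ := by
  refine norm_le_of_abs_apply_le fun n => ?_
  rw [abs_of_nonneg (tailPos_apply_nonneg x n), tailPos_apply]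
  split_ifs
  · exact abs_nonneg _
  · exact max_le (le_abs_self _) (abs_nonneg _)

theorem norm_tailPos_add_le (x y : RealEll2) :
    ‖tailPos (x + y)‖ ≤ ‖tailPos x‖ + ‖tailPos y‖ := by
  refine (norm_le_of_abs_apply_le fun n => ?_).trans (norm_add_le (tailPos x) (tailPos y))
  rw [abs_of_nonneg (tailPos_apply_nonneg _ n)]
  refine le_trans ?_ (le_abs_self _)
  simp only [lp.coeFn_add, Pi.add_apply, tailPos_apply]
  split_ifs
  · simp
  · exact max_le (add_le_add (le_max_left _ _) (le_max_left _ _))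
      (add_nonneg (le_max_right _ _) (le_max_right _ _))

theorem tailPos_smul {c : ℝ} (hc : 0 ≤ c) (x : RealEll2) : tailPos (c • x) = c • tailPos x := by
  ext n
  simp only [lp.coeFn_smul, Pi.smul_apply, tailPos_apply, smul_eq_mul]
  split_ifs
  · simp
  · rw [mul_max_of_nonneg _ _ hc, mul_zero]

theorem tailPos_ellE1 : tailPos ellE1 = 0 := by
  ext n
  simp only [lp.coeFn_zero, Pi.zero_apply, tailPos_apply]
  split_ifs with h
  · rfl
  · simp [ellE1_apply_of_ne h]

theorem tailPos_neg_ellE1 : tailPos (-ellE1) = 0 := by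
  ext n
  simp only [lp.coeFn_zero, lp.coeFn_neg, Pi.neg_apply, Pi.zero_apply, tailPos_apply]
  split_ifs with h
  · rfl
  · simp [ellE1_apply_of_ne h]

theorem eq_smul_ellE1_add_tailPos_sub (x : RealEll2) :
    x = x 0 • ellE1 + (tailPos x - tailPos (-x)) := by
  ext n
  simp only [lp.coeFn_add, lp.coeFn_smul, lp.coeFn_sub, lp.coeFn_neg, Pi.add_apply, Pi.smul_apply,
    Pi.sub_apply, Pi.neg_apply, smul_eq_mul, tailPos_apply]
  by_cases h : n = 0
  · subst h
    simp [ellE1_apply_zero]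
  · simp only [h, if_false, ellE1_apply_of_ne h, mul_zero, zero_add]
    rcases le_total (x n) 0 with h' | h'
    · rw [max_eq_right h', max_eq_left (by linarith)]
      ring
    · rw [max_eq_left h', max_eq_right (by linarith)]
      ring

theorem inner_ellE1_left (x : RealEll2) : inner ℝ ellE1 x = x 0 := by
  simp [ellE1, lp.inner_single_left]

theorem inner_ellE1_right (x : RealEll2) : inner ℝ x ellE1 = x 0 := by
  rw [real_inner_comm, inner_ellE1_left]

theorem inner_nonneg_of_apply_nonneg {x y : RealEll2} (hx : ∀ n, 0 ≤ x n) (hy : ∀ n, 0 ≤ y n) :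
    0 ≤ inner ℝ x y := by
  rw [lp.inner_eq_tsum]
  exact tsum_nonneg fun n => mul_nonneg (hy n) (hx n)

theorem inner_tailPos_nonneg (x y : RealEll2) : 0 ≤ inner ℝ (tailPos x) (tailPos y) :=
  inner_nonneg_of_apply_nonneg (tailPos_apply_nonneg x) (tailPos_apply_nonneg y)

theorem inner_tailPos_neg_tailPos (x : RealEll2) :
    inner ℝ (tailPos (-x)) (tailPos x) = 0 := by
  rw [lp.inner_eq_tsum]
  refine (tsum_congr fun n => ?_).trans tsum_zero
  rw [tailPos_apply, tailPos_apply]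
  split_ifs
  · simp
  · rcases le_total (x n) 0 with h' | h'
    · rw [max_eq_right h', inner_zero_right]
    · rw [max_eq_right (a := (-x) n) (by simpa using h'), inner_zero_left]

theorem inner_self_tailPos (x : RealEll2) : inner ℝ x (tailPos x) = ‖tailPos x‖ ^ 2 := by
  have h : inner ℝ x (tailPos x) =
      inner ℝ (x 0 • ellE1 + (tailPos x - tailPos (-x))) (tailPos x) :=
    congrArg (fun z => inner ℝ z (tailPos x)) (eq_smul_ellE1_add_tailPos_sub x)
  rw [h, inner_add_left, inner_sub_left, inner_smul_left,
    inner_ellE1_left, inner_tailPos_neg_tailPos, tailPos_zero_coord, real_inner_self_eq_norm_sq]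
  simp

theorem inner_eq_zero_coord_add (x y : RealEll2) :
    inner ℝ x y = x 0 * y 0 +
      inner ℝ (tailPos x - tailPos (-x)) (tailPos y - tailPos (-y)) := by
  have h0 : ∀ z : RealEll2, (tailPos z - tailPos (-z)) 0 = 0 := fun z => by
    simp [tailPos_zero_coord]
  conv_lhs => rw [eq_smul_ellE1_add_tailPos_sub x, eq_smul_ellE1_add_tailPos_sub y]
  rw [inner_add_left, inner_add_right, inner_add_right, real_inner_smul_left,
    real_inner_smul_left, real_inner_smul_right, real_inner_smul_right, inner_ellE1_left,
    inner_ellE1_left, inner_ellE1_right, h0, h0, ellE1_apply_zero]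
  ring

/-! ### The norm -/

/-- The value at `x = (t, w)` of the new norm, `max (‖w⁺‖ - t) (‖w⁻‖ + t)`. -/
noncomputable def coneNorm (x : RealEll2) : ℝ :=
  max (‖tailPos x‖ - x 0) (‖tailPos (-x)‖ + x 0)

theorem coneNorm_neg (x : RealEll2) : coneNorm (-x) = coneNorm x := by
  unfold coneNorm
  rw [neg_neg, max_comm, lp.coeFn_neg, Pi.neg_apply, sub_neg_eq_add, ← sub_eq_add_neg]

theorem coneNorm_le_iff {x : RealEll2} {r : ℝ} :
    coneNorm x ≤ r ↔ ‖tailPos x‖ - x 0 ≤ r ∧ ‖tailPos (-x)‖ + x 0 ≤ r := max_le_iff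

theorem coneNorm_add_le (x y : RealEll2) : coneNorm (x + y) ≤ coneNorm x + coneNorm y := by
  have hx := coneNorm_le_iff.1 (le_refl (coneNorm x))
  have hy := coneNorm_le_iff.1 (le_refl (coneNorm y))
  have h1 := norm_tailPos_add_le x y
  have h2 := norm_tailPos_add_le (-x) (-y)
  rw [coneNorm_le_iff, neg_add, lp.coeFn_add, Pi.add_apply]
  constructor <;> linarith [hx.1, hx.2, hy.1, hy.2]

theorem coneNorm_smul_of_nonneg {c : ℝ} (hc : 0 ≤ c) (x : RealEll2) :
    coneNorm (c • x) = c * coneNorm x := by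
  unfold coneNorm
  rw [← smul_neg, tailPos_smul hc, tailPos_smul hc, norm_smul, norm_smul, Real.norm_of_nonneg hc,
    lp.coeFn_smul, Pi.smul_apply, smul_eq_mul, mul_max_of_nonneg _ _ hc]
  ring_nf

theorem coneNorm_smul (c : ℝ) (x : RealEll2) : coneNorm (c • x) = ‖c‖ * coneNorm x := by
  rcases le_total 0 c with hc | hc
  · rw [coneNorm_smul_of_nonneg hc, Real.norm_of_nonneg hc]
  · rw [← coneNorm_neg, ← neg_smul, coneNorm_smul_of_nonneg (neg_nonneg.2 hc),
      Real.norm_of_nonpos hc]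

theorem coneNorm_le (x : RealEll2) : coneNorm x ≤ 2 * ‖x‖ := by
  have h0 := abs_le.1 (lp.norm_apply_le_norm two_ne_zero x 0)
  have h1 := norm_tailPos_le x
  have h2 := norm_tailPos_le (-x)
  rw [norm_neg] at h2
  rw [coneNorm_le_iff]
  constructor <;> linarith [h0.1, h0.2]

theorem abs_apply_zero_le_coneNorm (x : RealEll2) : |x 0| ≤ coneNorm x := by
  have hx := coneNorm_le_iff.1 (le_refl (coneNorm x))
  rw [abs_le]
  constructor <;> linarith [hx.1, hx.2, norm_nonneg (tailPos x), norm_nonneg (tailPos (-x))]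

theorem norm_ellE1 : ‖ellE1‖ = 1 := by
  rw [ellE1, lp.norm_single (by norm_num), norm_one]

theorem norm_le_coneNorm (x : RealEll2) : 3⁻¹ * ‖x‖ ≤ coneNorm x := by
  have hx := coneNorm_le_iff.1 (le_refl (coneNorm x))
  have h0 := abs_apply_zero_le_coneNorm x
  have h : ‖x‖ ≤ |x 0| + (‖tailPos x‖ + ‖tailPos (-x)‖) := by
    conv_lhs => rw [eq_smul_ellE1_add_tailPos_sub x]
    refine (norm_add_le _ _).trans (add_le_add ?_ (norm_sub_le _ _))
    rw [norm_smul, norm_ellE1, mul_one, Real.norm_eq_abs]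
  linarith [hx.1, hx.2]

/-- The renorming of `ℓ₂` by `coneNorm`. -/
noncomputable def coneRenorming : EquivalentNorm RealEll2 where
  toSeminorm := Seminorm.of coneNorm coneNorm_add_le coneNorm_smul
  exists_lower := ⟨3⁻¹, by norm_num, norm_le_coneNorm⟩
  exists_upper := ⟨2, by norm_num, coneNorm_le⟩

theorem norm_of_coneRenorming (x : RealEll2) :
    ‖Renormed.of coneRenorming x‖ = coneNorm x := rfl

theorem coneNorm_ellE1 : coneNorm ellE1 = 1 := by
  rw [coneNorm, tailPos_ellE1, tailPos_neg_ellE1, ellE1_apply_zero]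
  norm_num

/-! ### The geometry of the unit ball at the first basis vector -/

/-- `e₁` is not a nontrivial convex combination of vectors of the unit ball: the first coordinates
force the vectors into the face `t = 1`, on which the tails are nonnegative, and nonnegative tails
with vanishing mean vanish. -/
theorem eq_ellE1_of_sum_smul_eq {ι : Type*} [Fintype ι] {w : ι → ℝ} {z : ι → RealEll2}
    (hw : ∀ i, 0 ≤ w i) (hw1 : ∑ i, w i = 1) (hz : ∀ i, coneNorm (z i) ≤ 1)
    (hsum : ∑ i, w i • z i = ellE1) {i : ι} (hi : 0 < w i) : z i = ellE1 := by
  have hcoord : ∀ n, ∑ j, w j * z j n = ellE1 n := fun n => by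
    rw [← hsum, lp.coeFn_sum, Finset.sum_apply]
    rfl
  have h0 : ∀ j, 0 < w j → z j 0 = 1 := by
    have hnn : ∀ j ∈ Finset.univ, 0 ≤ w j * (1 - z j 0) := fun j _ =>
      mul_nonneg (hw j) (sub_nonneg.2 ((le_abs_self _).trans
        ((abs_apply_zero_le_coneNorm _).trans (hz j))))
    have hs : ∑ j, w j * (1 - z j 0) = 0 := by
      simp only [mul_sub, mul_one, Finset.sum_sub_distrib, hw1, hcoord, ellE1_apply_zero, sub_self]
    intro j hj
    have := (Finset.sum_eq_zero_iff_of_nonneg hnn).1 hs j (Finset.mem_univ j)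
    rcases mul_eq_zero.1 this with h | h <;> linarith
  have hpos : ∀ j, 0 < w j → ∀ n, n ≠ 0 → 0 ≤ z j n := by
    intro j hj n hn
    have h1 := (coneNorm_le_iff.1 (hz j)).2
    rw [h0 j hj] at h1
    have h2 : tailPos (-z j) = 0 := norm_le_zero_iff.1 (by linarith)
    have h3 := tailPos_apply_of_ne (-z j) hn
    rw [h2, lp.coeFn_zero, lp.coeFn_neg, Pi.neg_apply, Pi.zero_apply] at h3
    linarith [le_max_left (-z j n) 0]
  ext n
  by_cases hn : n = 0
  · subst hn
    rw [h0 i hi, ellE1_apply_zero]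
  · have hs := hcoord n
    rw [ellE1_apply_of_ne hn] at hs ⊢
    have hnn : ∀ j ∈ Finset.univ, 0 ≤ w j * z j n := fun j _ => by
      rcases (hw j).eq_or_lt with h | h
      · rw [← h, zero_mul]
      · exact mul_nonneg h.le (hpos j h n hn)
    have := (Finset.sum_eq_zero_iff_of_nonneg hnn).1 hs i (Finset.mem_univ i)
    exact (mul_eq_zero.1 this).resolve_left hi.ne'

/-- Changing a single tail coordinate of a vector of the unit ball suffices to reach distance `2`
from `e₁` inside the ball. -/
theorem exists_update_dist_eq_two {x : RealEll2} (hx : coneNorm x ≤ 1) {n : ℕ} (hn : n ≠ 0) :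
    ∃ c : ℝ, |c| ≤ 2 + ‖x‖ ∧ coneNorm (x + lp.single 2 n c) ≤ 1 ∧
      coneNorm (ellE1 - (x + lp.single 2 n c)) = 2 := by
  obtain ⟨hx1, hx2⟩ := coneNorm_le_iff.1 hx
  have hx0 := abs_le.1 ((abs_apply_zero_le_coneNorm x).trans hx)
  -- `v` is `x` with the coordinate `n` set to zero
  set v : RealEll2 := x - lp.single 2 n (x n) with hv
  have hvm : ∀ m, v m = if m = n then 0 else x m := fun m => by
    rw [hv, lp.coeFn_sub, Pi.sub_apply, single_apply_real]
    split_ifs with h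
    · rw [h, sub_self]
    · rw [sub_zero]
  have hv1 : ‖tailPos v‖ ≤ ‖tailPos x‖ := norm_le_of_abs_apply_le fun m => by
    simp only [tailPos_apply, hvm]
    split_ifs <;> simp
  have hv2 : ‖tailPos (-v)‖ ≤ ‖tailPos (-x)‖ := norm_le_of_abs_apply_le fun m => by
    simp only [tailPos_apply, lp.coeFn_neg, Pi.neg_apply, hvm]
    split_ifs <;> simp
  set s : ℝ := √((1 + x 0) ^ 2 - ‖tailPos v‖ ^ 2) with hs
  have hs0 : 0 ≤ s := Real.sqrt_nonneg _
  have hs2 : s ^ 2 = (1 + x 0) ^ 2 - ‖tailPos v‖ ^ 2 :=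
    Real.sq_sqrt (by nlinarith [norm_nonneg (tailPos v)])
  have hsle : s ≤ 2 := by nlinarith [norm_nonneg (tailPos v), hx0.1, hx0.2]
  have hy : x + lp.single 2 n (s - x n) = v + lp.single 2 n s := by
    rw [hv, lp.single_sub]
    abel
  have hy0 : (v + lp.single 2 n s : RealEll2) 0 = x 0 := by
    rw [lp.coeFn_add, Pi.add_apply, single_apply_real, if_neg hn.symm, hvm, if_neg hn.symm,
      add_zero]
  have hp : tailPos (v + lp.single 2 n s) = tailPos v + lp.single 2 n s := by
    ext m
    simp only [tailPos_apply, lp.coeFn_add, Pi.add_apply, single_apply_real, hvm]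
    by_cases h : m = n
    · subst h
      simp [hn, hs0]
    · simp [h]
  have hm : tailPos (-(v + lp.single 2 n s)) = tailPos (-v) := by
    ext m
    simp only [tailPos_apply, lp.coeFn_neg, Pi.neg_apply, lp.coeFn_add, Pi.add_apply,
      single_apply_real, hvm]
    by_cases h : m = n
    · subst h
      simp [hn, hs0]
    · simp [h]
  have hnorm : ‖tailPos v + lp.single 2 n s‖ = 1 + x 0 := by
    have horth : inner ℝ (tailPos v) (lp.single 2 n s : RealEll2) = 0 := by
      rw [lp.inner_single_right, tailPos_apply_of_ne _ hn, hvm]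
      simp
    have h := norm_add_sq_real (tailPos v) (lp.single 2 n s : RealEll2)
    rw [horth, lp.norm_single (by norm_num), Real.norm_of_nonneg hs0, hs2] at h
    refine (sq_eq_sq₀ (norm_nonneg _) (by linarith [hx0.1])).1 ?_
    linarith
  refine ⟨s - x n, ?_, ?_, ?_⟩
  · refine (abs_sub _ _).trans (add_le_add ?_ (lp.norm_apply_le_norm two_ne_zero x n))
    rwa [abs_of_nonneg hs0]
  · rw [hy, coneNorm_le_iff, hp, hm, hnorm, hy0]
    constructor <;> linarith
  · -- subtracting `e₁` only affects the coordinate `0`, which `tailPos` ignores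
    have htail : ∀ z : RealEll2, tailPos (ellE1 + z) = tailPos z := fun z => by
      ext m
      simp only [tailPos_apply, lp.coeFn_add, Pi.add_apply]
      split_ifs with h
      · rfl
      · rw [ellE1_apply_of_ne h, zero_add]
    have htail' : ∀ z : RealEll2, tailPos (-(ellE1 - z)) = tailPos z := fun z => by
      ext m
      simp only [tailPos_apply, lp.coeFn_neg, lp.coeFn_sub, Pi.neg_apply, Pi.sub_apply]
      split_ifs with h
      · rfl
      · rw [ellE1_apply_of_ne h, zero_sub, neg_neg]
    have hd0 : (ellE1 - (v + lp.single 2 n s : RealEll2)) 0 = 1 - x 0 := by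
      rw [lp.coeFn_sub, Pi.sub_apply, hy0, ellE1_apply_zero]
    rw [hy, coneNorm, htail', hp, hnorm, hd0, sub_eq_add_neg ellE1, htail, hm,
      max_eq_right (by linarith)]
    ring

/-! ### Normed spaces isometric to the renormed space -/

section Model

variable {E : Type*} [NormedAddCommGroup E] [NormedSpace ℝ E] {Φ : RealEll2 →ₗ[ℝ] E}

/-- A bounded perturbation of the coordinate `n` is weakly negligible as `n → ∞`: it eventually
stays in a given weak neighbourhood. -/
theorem eventually_mem_of_isOpen_weak (hΦ : ∀ x, ‖Φ x‖ = coneNorm x) (x : RealEll2) {c : ℕ → ℝ}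
    {C : ℝ} (hc : ∀ᶠ n in atTop, |c n| ≤ C) {U : Set (WeakSpace ℝ E)} (hU : IsOpen U)
    (hx : toWeakSpace ℝ E (Φ x) ∈ U) :
    ∀ᶠ n in atTop, toWeakSpace ℝ E (Φ (x + lp.single 2 n (c n))) ∈ U := by
  have key : Tendsto (fun n => toWeakSpace ℝ E (Φ (x + lp.single 2 n (c n)))) atTop
      (𝓝 (toWeakSpace ℝ E (Φ x))) := by
    refine (WeakBilin.tendsto_iff_forall_eval_tendsto _ ?_).2 fun f => ?_
    · intro a b hab
      exact (SeparatingDual.eq_iff_forall_dual_eq (R := ℝ)).2 fun g =>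
        DFunLike.congr_fun hab g
    · let Φc : RealEll2 →L[ℝ] E := Φ.mkContinuous 2 fun y => (hΦ y).trans_le (coneNorm_le y)
      let g : RealEll2 := (InnerProductSpace.toDual ℝ RealEll2).symm (f.comp Φc)
      have hg : ∀ y, f (Φ y) = inner ℝ g y := fun y =>
        (InnerProductSpace.toDual_symm_apply (x := y) (y := f.comp Φc)).symm
      have hg0 : Tendsto (fun n => g n) atTop (𝓝 0) := by
        have h := lp.summable_inner (𝕜 := ℝ) g g
        have h2 := h.tendsto_atTop_zero
        have h3 : Tendsto (fun n => |g n|) atTop (𝓝 0) := by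
          have := h2.sqrt
          simpa [Real.sqrt_sq_eq_abs, ← sq, Real.sqrt_mul_self_eq_abs] using this
        exact (tendsto_zero_iff_abs_tendsto_zero _).2 h3
      have hlim : Tendsto (fun n => f (Φ x) + g n * c n) atTop (𝓝 (f (Φ x) + 0)) :=
        tendsto_const_nhds.add (hg0.zero_mul_isBoundedUnder_le
          ⟨C, by simpa using hc⟩)
      rw [add_zero] at hlim
      refine hlim.congr fun n => ?_
      change _ = f (Φ (x + lp.single 2 n (c n)))
      rw [map_add, map_add, hg (lp.single 2 n (c n)), lp.inner_single_right]
      simp [mul_comm]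
  exact key.eventually (hU.mem_nhds hx)

theorem injective_of_norm_eq_coneNorm (hΦ : ∀ x, ‖Φ x‖ = coneNorm x) : Function.Injective Φ := by
  refine (injective_iff_map_eq_zero Φ).2 fun x hx => ?_
  have h := norm_le_coneNorm x
  rw [← hΦ, hx, norm_zero] at h
  exact norm_le_zero_iff.1 (by linarith)

theorem mem_extremePoints_of_norm_eq_coneNorm (hΦ : ∀ x, ‖Φ x‖ = coneNorm x)
    (hsurj : Function.Surjective Φ) :
    Φ ellE1 ∈ Set.extremePoints ℝ (Metric.closedBall (0 : E) 1) := by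
  refine mem_extremePoints_iff_left.2 ⟨?_, ?_⟩
  · rw [mem_closedBall_zero_iff, hΦ, coneNorm_ellE1]
  · intro a ha b hb hab
    obtain ⟨a, rfl⟩ := hsurj a
    obtain ⟨b, rfl⟩ := hsurj b
    obtain ⟨α, β, hα, hβ, hαβ, h⟩ := hab
    refine congrArg Φ (eq_ellE1_of_sum_smul_eq (w := ![α, β]) (z := ![a, b]) (i := 0)
      ?_ ?_ ?_ ?_ hα)
    · simp [Fin.forall_fin_two, hα.le, hβ.le]
    · simp [hαβ]
    · rw [mem_closedBall_zero_iff, hΦ] at ha hb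
      simp [Fin.forall_fin_two, ha, hb]
    · apply injective_of_norm_eq_coneNorm hΦ
      simp [← h]

theorem isSuperDaugavetPoint_of_norm_eq_coneNorm (hΦ : ∀ x, ‖Φ x‖ = coneNorm x)
    (hsurj : Function.Surjective Φ) : IsSuperDaugavetPoint (Φ ellE1) := by
  have h1 : ‖Φ ellE1‖ = 1 := by rw [hΦ, coneNorm_ellE1]
  refine ⟨h1, ?_⟩
  rintro V ⟨U, hU, rfl⟩ ⟨y, hy, hyU⟩
  obtain ⟨x, rfl⟩ := hsurj y
  rw [mem_closedBall_zero_iff, hΦ] at hy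
  have hex : ∀ n : ℕ, ∃ c : ℝ, n ≠ 0 → |c| ≤ 2 + ‖x‖ ∧ coneNorm (x + lp.single 2 n c) ≤ 1 ∧
      coneNorm (ellE1 - (x + lp.single 2 n c)) = 2 := fun n => by
    by_cases hn : n = 0
    · exact ⟨0, fun h => absurd hn h⟩
    · obtain ⟨c, hc⟩ := exists_update_dist_eq_two hy hn
      exact ⟨c, fun _ => hc⟩
  choose c hc using hex
  have hne := eventually_ne_atTop (0 : ℕ)
  obtain ⟨n, hn, hnU⟩ := (hne.and (eventually_mem_of_isOpen_weak hΦ x (c := c)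
    (hne.mono fun n hn => (hc n hn).1) hU hyU)).exists
  obtain ⟨-, hball, hdist⟩ := hc n hn
  refine IsGreatest.isLUB ⟨⟨Φ (x + lp.single 2 n (c n)), ⟨?_, hnU⟩, ?_⟩, ?_⟩
  · rwa [mem_closedBall_zero_iff, hΦ]
  · change ‖Φ ellE1 - Φ (x + lp.single 2 n (c n))‖ = 2
    rw [← map_sub, hΦ, hdist]
  · rintro _ ⟨z, ⟨hz, -⟩, rfl⟩
    rw [mem_closedBall_zero_iff] at hz
    exact (norm_sub_le _ _).trans (by linarith)

theorem isCcwDeltaPoint_of_norm_eq_coneNorm (hΦ : ∀ x, ‖Φ x‖ = coneNorm x)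
    (hsurj : Function.Surjective Φ) : IsCcwDeltaPoint (Φ ellE1) := by
  have h1 : ‖Φ ellE1‖ = 1 := by rw [hΦ, coneNorm_ellE1]
  refine ⟨h1, ?_⟩
  rintro C ⟨k, w, W, hw, hw1, hW, rfl⟩ ⟨z, hz, hsum⟩
  choose U hU hWU using fun i => (hW i).1
  choose p hp using hsurj
  have hball : ∀ i, ∀ y ∈ W i, ‖y‖ ≤ 1 := fun i y hy => by
    rw [hWU i] at hy
    exact mem_closedBall_zero_iff.1 hy.1
  have hze : ∀ i, 0 < w i → z i = Φ ellE1 := fun i hi => by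
    rw [← hp (z i)]
    refine congrArg Φ (eq_ellE1_of_sum_smul_eq (z := fun i => p (z i)) hw hw1 (fun j => ?_) ?_ hi)
    · rw [← hΦ, hp]
      exact hball j _ (hz j)
    · apply injective_of_norm_eq_coneNorm hΦ
      simp only [map_sum, map_smul, hp, hsum]
  -- For `x = e₁` the perturbation that reaches distance `2` can be chosen independently of `i`.
  have hex : ∀ n : ℕ, ∃ c : ℝ, n ≠ 0 → |c| ≤ 2 + ‖ellE1‖ ∧
      coneNorm (ellE1 + lp.single 2 n c) ≤ 1 ∧
      coneNorm (ellE1 - (ellE1 + lp.single 2 n c)) = 2 := fun n => by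
    by_cases hn : n = 0
    · exact ⟨0, fun h => absurd hn h⟩
    · obtain ⟨c, hc⟩ := exists_update_dist_eq_two coneNorm_ellE1.le hn
      exact ⟨c, fun _ => hc⟩
  choose c hc using hex
  have hne := eventually_ne_atTop (0 : ℕ)
  have hev : ∀ᶠ n in atTop, ∀ i, 0 < w i →
      toWeakSpace ℝ E (Φ (ellE1 + lp.single 2 n (c n))) ∈ U i := by
    refine eventually_all.2 fun i => ?_
    by_cases hi : 0 < w i
    · have hmem : Φ ellE1 ∈ W i := hze i hi ▸ hz i
      rw [hWU i] at hmem
      exact (eventually_mem_of_isOpen_weak hΦ ellE1 (c := c)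
        (hne.mono fun n hn => (hc n hn).1) (hU i) hmem.2).mono fun _ h _ => h
    · exact Eventually.of_forall fun _ h => absurd h hi
  obtain ⟨n, hn, hnU⟩ := (hne.and hev).exists
  obtain ⟨-, hyball, hdist⟩ := hc n hn
  set y := Φ (ellE1 + lp.single 2 n (c n)) with hy
  have hsumy : y = ∑ i, w i • (if 0 < w i then y else z i) := by
    have : ∀ i, w i • (if 0 < w i then y else z i) = w i • y := fun i => by
      split_ifs with h
      · rfl
      · rw [le_antisymm (not_lt.1 h) (hw i), zero_smul, zero_smul]
    simp only [this, ← Finset.sum_smul, hw1, one_smul]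
  refine IsGreatest.isLUB ⟨⟨y, ⟨_, fun i => ?_, hsumy⟩, ?_⟩, ?_⟩
  · split_ifs with h
    · rw [hWU i]
      refine ⟨?_, hnU i h⟩
      rwa [mem_closedBall_zero_iff, hΦ]
    · exact hz i
  · change ‖Φ ellE1 - y‖ = 2
    rw [hy, ← map_sub, hΦ, hdist]
  · rintro _ ⟨_, ⟨u, hu, rfl⟩, rfl⟩
    have hu1 : ‖∑ i, w i • u i‖ ≤ 1 := by
      refine (norm_sum_le _ _).trans (hw1 ▸ Finset.sum_le_sum fun i _ => ?_)
      rw [norm_smul, Real.norm_of_nonneg (hw i)]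
      exact mul_le_of_le_one_right (hw i) (hball i _ (hu i))
    exact (norm_sub_le _ _).trans (by linarith)

end Model

/-! ### Self-duality of the renormed space -/

/-- The vector `(t, -w/2)`, for `x = (t, w)`. -/
noncomputable def dualVector : RealEll2 →ₗ[ℝ] RealEll2 where
  toFun x := (3 / 2 * x 0) • ellE1 - (2⁻¹ : ℝ) • x
  map_add' x y := by
    rw [lp.coeFn_add, Pi.add_apply]
    module
  map_smul' c x := by
    rw [lp.coeFn_smul, Pi.smul_apply, smul_eq_mul, RingHom.id_apply]
    module

theorem dualVector_apply (x : RealEll2) :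
    dualVector x = (3 / 2 * x 0) • ellE1 - (2⁻¹ : ℝ) • x := rfl

/-- The functional `(u, v) ↦ t u - ⟪w, v⟫ / 2` on the renormed space, for `x = (t, w)`. -/
noncomputable def dualMap : RealEll2 →ₗ[ℝ] StrongDual ℝ (Renormed coneRenorming) where
  toFun x := (innerSL ℝ (dualVector x)).comp
    ((Renormed.of coneRenorming).symm : Renormed coneRenorming →L[ℝ] RealEll2)
  map_add' x y := by
    ext z
    simp
  map_smul' c x := by
    ext z
    simp

theorem dualMap_apply_of (x y : RealEll2) : dualMap x (Renormed.of coneRenorming y) =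
    3 / 2 * (x 0 * y 0) - 2⁻¹ * inner ℝ x y := by
  change inner ℝ (dualVector x) y = _
  rw [dualVector_apply, inner_sub_left, real_inner_smul_left, real_inner_smul_left,
    inner_ellE1_left]
  ring

theorem dualMap_ellE1 : dualMap ellE1 = ellE1Dual coneRenorming := by
  have h : dualVector ellE1 = ellE1 := by
    rw [dualVector_apply, ellE1_apply_zero]
    module
  change (innerSL ℝ (dualVector ellE1)).comp _ = _
  rw [h]
  rfl

theorem dualMap_surjective : Function.Surjective dualMap := by
  intro f
  let g : RealEll2 := (InnerProductSpace.toDual ℝ RealEll2).symm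
    (f.comp (Renormed.of coneRenorming : RealEll2 →L[ℝ] Renormed coneRenorming))
  have hg : ∀ y, inner ℝ g y = f (Renormed.of coneRenorming y) := fun y =>
    InnerProductSpace.toDual_symm_apply
  refine ⟨(3 * g 0) • ellE1 - (2 : ℝ) • g, ?_⟩
  ext z
  obtain ⟨y, rfl⟩ := (Renormed.of coneRenorming).surjective z
  rw [dualMap_apply_of, ← hg, inner_sub_left, real_inner_smul_left, real_inner_smul_left,
    inner_ellE1_left, lp.coeFn_sub, Pi.sub_apply, lp.coeFn_smul, lp.coeFn_smul, Pi.smul_apply,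
    Pi.smul_apply, ellE1_apply_zero, smul_eq_mul, smul_eq_mul]
  ring

/-- Dropping the nonnegative terms `⟪w⁺, v⁺⟫` and `⟪w⁻, v⁻⟫` and applying Cauchy-Schwarz to the mixed
terms bounds `t u - ⟪w, v⟫ / 2` by `t u + (‖w⁺‖ ‖v⁻‖ + ‖w⁻‖ ‖v⁺‖) / 2`; here `‖w⁺‖ ≤ N x + t`,
`‖w⁻‖ ≤ N x - t`, and likewise for `v`. -/
theorem dualMap_apply_of_le (x y : RealEll2) :
    dualMap x (Renormed.of coneRenorming y) ≤ coneNorm x * coneNorm y := by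
  rw [dualMap_apply_of, inner_eq_zero_coord_add]
  obtain ⟨hx1, hx2⟩ := coneNorm_le_iff.1 (le_refl (coneNorm x))
  obtain ⟨hy1, hy2⟩ := coneNorm_le_iff.1 (le_refl (coneNorm y))
  simp only [inner_sub_left, inner_sub_right]
  have h1 := inner_tailPos_nonneg x y
  have h2 := inner_tailPos_nonneg (-x) (-y)
  have h3 : inner ℝ (tailPos x) (tailPos (-y)) ≤ (coneNorm x + x 0) * (coneNorm y - y 0) :=
    (real_inner_le_norm _ _).trans (mul_le_mul (by linarith) (by linarith) (norm_nonneg _)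
      (by linarith [norm_nonneg (tailPos x)]))
  have h4 : inner ℝ (tailPos (-x)) (tailPos y) ≤ (coneNorm x - x 0) * (coneNorm y + y 0) :=
    (real_inner_le_norm _ _).trans (mul_le_mul (by linarith) (by linarith) (norm_nonneg _)
      (by linarith [norm_nonneg (tailPos (-x))]))
  linarith

/-- The functional of `(t, w)` is tested on the vector `(-1, -2 w⁺/‖w⁺‖)` of the unit ball, or on
`(-1, 0)` if `w⁺ = 0`. -/
theorem norm_tailPos_sub_le_norm_dualMap (x : RealEll2) :
    ‖tailPos x‖ - x 0 ≤ ‖dualMap x‖ := by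
  -- if `w⁺ = 0`, then `2 / ‖w⁺‖ = 0` by convention, which gives the vector `(-1, 0)`
  set a : ℝ := 2 / ‖tailPos x‖ with ha
  have ha0 : 0 ≤ a := div_nonneg zero_le_two (norm_nonneg _)
  have hle : a * ‖tailPos x‖ ≤ 2 := by
    by_cases h : ‖tailPos x‖ = 0
    · rw [h, mul_zero]
      exact zero_le_two
    · rw [ha, div_mul_cancel₀ _ h]
  have hsq : a * ‖tailPos x‖ ^ 2 = 2 * ‖tailPos x‖ := by
    by_cases h : ‖tailPos x‖ = 0
    · rw [h]
      ring
    · rw [ha]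
      field_simp
  have hpp : tailPos (ellE1 + a • tailPos x) = a • tailPos x := by
    ext n
    simp only [tailPos_apply (ellE1 + a • tailPos x), lp.coeFn_add, lp.coeFn_smul, Pi.add_apply,
      Pi.smul_apply, smul_eq_mul]
    split_ifs with h
    · rw [h, tailPos_zero_coord, mul_zero]
    · rw [ellE1_apply_of_ne h, zero_add, max_eq_left (mul_nonneg ha0 (tailPos_apply_nonneg x n))]
  have hpm : tailPos (-(ellE1 + a • tailPos x)) = 0 := by
    ext n
    simp only [tailPos_apply (-(ellE1 + a • tailPos x)), lp.coeFn_add, lp.coeFn_smul,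
      lp.coeFn_neg, lp.coeFn_zero, Pi.zero_apply, Pi.neg_apply, Pi.add_apply, Pi.smul_apply,
      smul_eq_mul]
    split_ifs with h
    · rfl
    · rw [ellE1_apply_of_ne h, zero_add,
        max_eq_right (neg_nonpos.2 (mul_nonneg ha0 (tailPos_apply_nonneg x n)))]
  have h0 : (ellE1 + a • tailPos x) 0 = 1 := by
    rw [lp.coeFn_add, lp.coeFn_smul, Pi.add_apply, Pi.smul_apply, ellE1_apply_zero,
      tailPos_zero_coord, smul_zero, add_zero]
  have hball : coneNorm (-(ellE1 + a • tailPos x)) ≤ 1 := by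
    rw [coneNorm_neg, coneNorm_le_iff, hpp, hpm, h0, norm_smul, Real.norm_of_nonneg ha0, norm_zero]
    constructor <;> linarith
  have hval : dualMap x (Renormed.of coneRenorming (-(ellE1 + a • tailPos x))) =
      ‖tailPos x‖ - x 0 := by
    rw [dualMap_apply_of, lp.coeFn_neg, Pi.neg_apply, h0, inner_neg_right, inner_add_right,
      inner_ellE1_right, real_inner_smul_right, inner_self_tailPos, hsq]
    ring
  rw [← hval]
  refine (le_abs_self _).trans (((dualMap x).le_opNorm _).trans ?_)
  exact mul_le_of_le_one_right (norm_nonneg _) hball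

theorem norm_dualMap (x : RealEll2) : ‖dualMap x‖ = coneNorm x := by
  refine le_antisymm ?_ ?_
  · refine ContinuousLinearMap.opNorm_le_bound _ ((abs_nonneg _).trans
      (abs_apply_zero_le_coneNorm x)) fun z => ?_
    obtain ⟨y, rfl⟩ := (Renormed.of coneRenorming).surjective z
    rw [norm_of_coneRenorming]
    refine abs_le.2 ⟨?_, dualMap_apply_of_le x y⟩
    have h := dualMap_apply_of_le x (-y)
    rw [coneNorm_neg, map_neg, map_neg] at h
    linarith
  · have h := norm_tailPos_sub_le_norm_dualMap (-x)
    rw [map_neg, norm_neg, lp.coeFn_neg, Pi.neg_apply, sub_neg_eq_add] at h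
    exact coneNorm_le_iff.2 ⟨norm_tailPos_sub_le_norm_dualMap x, h⟩

theorem theorem4p11 :
    ∃ N : EquivalentNorm RealEll2,
      (Renormed.of N ellE1 ∈ Set.extremePoints ℝ (Metric.closedBall (0 : Renormed N) 1) ∧
        IsSuperDaugavetPoint (Renormed.of N ellE1) ∧
        IsCcwDeltaPoint (Renormed.of N ellE1)) ∧
      (ellE1Dual N ∈
          Set.extremePoints ℝ (Metric.closedBall (0 : StrongDual ℝ (Renormed N)) 1) ∧
        IsSuperDaugavetPoint (ellE1Dual N) ∧
        IsCcwDeltaPoint (ellE1Dual N)) := by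
  have hΦ : ∀ x,
      ‖(Renormed.ofLinearEquiv coneRenorming : RealEll2 →ₗ[ℝ] Renormed coneRenorming) x‖ =
        coneNorm x :=
    norm_of_coneRenorming
  have hsurj : Function.Surjective
      (Renormed.ofLinearEquiv coneRenorming : RealEll2 →ₗ[ℝ] Renormed coneRenorming) :=
    (Renormed.ofLinearEquiv coneRenorming).surjective
  refine ⟨coneRenorming, ⟨mem_extremePoints_of_norm_eq_coneNorm hΦ hsurj,
    isSuperDaugavetPoint_of_norm_eq_coneNorm hΦ hsurj,
    isCcwDeltaPoint_of_norm_eq_coneNorm hΦ hsurj⟩, ?_⟩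
  rw [← dualMap_ellE1]
  exact ⟨mem_extremePoints_of_norm_eq_coneNorm norm_dualMap dualMap_surjective,
    isSuperDaugavetPoint_of_norm_eq_coneNorm norm_dualMap dualMap_surjective,
    isCcwDeltaPoint_of_norm_eq_coneNorm norm_dualMap dualMap_surjective⟩
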